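/- Let $n\ge 0$ and $d,p,D\ge 1$ be integers and let $0\le\sigma^2<1$. Consider data $\{(y_i,\mathcal A_i)\}_{i=1}^n$ with $y_i\in\mathbb R$ and $\mathcal A_i\in\mathbb R^{p\times\cdots\times p}$ an order-$d$ tensor, and the two hypotheses: $H_0$: all the $y_i$ and all the entries of all the $\mathcal A_i$ are i.i.d. $N(0,1)$. $H_1$: a vector $x^*=(x_1^*,\dots,x_p^*)$ with i.i.d. entries uniform on $\{p^{-1/2},-p^{-1/2}\}$ is drawn once, $\mathcal X^*=\sqrt{1-\sigma^2}\,(x^*)^{\otimes d}$, and $y_i=\langle\mathcal X^*,\mathcal A_i\rangle+\varepsilon_i$ for $i=1,\dots,n$, where the $\mathcal A_i$ have i.i.d. $N(0,1)$ entries, the $\varepsilon_i$ are i.i.d. $N(0,\sigma^2)$, and $x^*$, $(\mathcal A_i)_i$, $(\varepsilon_i)_i$ are independent. Let $0<\delta<1$ and suppose that $$n\le\frac{\delta}{2(1-\sigma^2)}\Big(\frac{p}{dD}\Big)^{d/2}.$$ Then every real polynomial $f$ of total degree at most $D$ in the $n(1+p^d)$ scalar coordinates of the data with $\mathbb E_{H_0}f=0$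 and $\mathrm{Var}_{H_0}f=1$ is integrable under $H_1$ and satisfies $$\mathbb E_{H_1}f\le\sqrt{\frac{\delta}{1-\delta}}.$$ If $d$ is odd, then moreover $\mathbb E_{H_1}f\le\frac{\delta}{1-\delta}$. -/

import Mathlib

open MeasureTheory ProbabilityTheory

noncomputable section

namespace TensorRegression

/-- Real order-`d` tensors of size `p × ⋯ × p`. -/
abbrev Tensor (d p : ℕ) : Type := (Fin d → Fin p) → ℝ

/-- The entrywise inner product of two tensors. -/
def tensorInner {d p : ℕ} (X A : Tensor d p) : ℝ := ∑ j, X j * A j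

/-- The planted tensor `√(1 - σ²) x^{⊗ d}`. -/
def plantedTensor (d p : ℕ) (σ : ℝ) (x : Fin p → ℝ) : Tensor d p :=
  fun j => √(1 - σ ^ 2) * ∏ k, x (j k)

/-- A data set of `n` pairs `(y_i, A_i)`. -/
abbrev Data (n d p : ℕ) : Type := Fin n → ℝ × Tensor d p

/-- The scalar coordinates of a data set: `(i, none)` stands for `y_i` and `(i, some j)` for the
entry of `A_i` at the multi-index `j`. -/
abbrev Coord (n d p : ℕ) : Type := Fin n × Option (Fin d → Fin p)

/-- The value of a scalar coordinate of a data set. -/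
def coordValue {n d p : ℕ} (z : Data n d p) : Coord n d p → ℝ
  | (i, none) => (z i).1
  | (i, some j) => (z i).2 j

/-- The value of a polynomial in the `n (1 + p ^ d)` scalar coordinates at a data set. -/
def polyEval {n d p : ℕ} (f : MvPolynomial (Coord n d p) ℝ) (z : Data n d p) : ℝ :=
  MvPolynomial.eval (coordValue z) f

/-- The law of a tensor with i.i.d. standard Gaussian entries. -/
def gaussianTensor (d p : ℕ) : Measure (Tensor d p) :=
  Measure.pi fun _ => gaussianReal 0 1

/-- The null law `H₀`: all the `y_i` and all the entries of the `A_i` are i.i.d. standard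
Gaussian. -/
def nullLaw (n d p : ℕ) : Measure (Data n d p) :=
  Measure.pi fun _ => (gaussianReal 0 1).prod (gaussianTensor d p)

/-- The uniform law on `{p^{-1/2}, -p^{-1/2}}`. -/
def scaledRademacher (p : ℕ) : Measure ℝ :=
  (2⁻¹ : ENNReal) • Measure.dirac ((√(p : ℝ))⁻¹) + (2⁻¹ : ENNReal) • Measure.dirac (-(√(p : ℝ))⁻¹)

/-- The law of the planted vector: i.i.d. entries, uniform on `{p^{-1/2}, -p^{-1/2}}`. -/
def plantedVectorLaw (p : ℕ) : Measure (Fin p → ℝ) :=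
  Measure.pi fun _ => scaledRademacher p

/-- The regression model: from the planted vector `x`, the covariates `A` and the noise `ε` form
the data `(y_i, A_i)`, `y_i = ⟨√(1 - σ²) x^{⊗ d}, A_i⟩ + ε_i`. -/
def regressionData {n d p : ℕ} (σ : ℝ)
    (ω : (Fin p → ℝ) × (Fin n → Tensor d p) × (Fin n → ℝ)) : Data n d p :=
  fun i => (tensorInner (plantedTensor d p σ ω.1) (ω.2.1 i) + ω.2.2 i, ω.2.1 i)

/-- The planted law `H₁`: the law of the regression data when the planted vector, the standard
Gaussian covariates and the `N(0, σ²)` noise are independent. The planted vector is drawn once and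
shared by the `n` samples. -/
def plantedLaw (n d p : ℕ) (σ : ℝ) : Measure (Data n d p) :=
  Measure.map (regressionData σ)
    ((plantedVectorLaw p).prod
      ((Measure.pi fun _ : Fin n => gaussianTensor d p).prod
        (Measure.pi fun _ : Fin n => gaussianReal 0 (Real.toNNReal (σ ^ 2)))))

end TensorRegression

end

/-! Fix `x` and put `u = √(1 - σ²) x^{⊗ d}`. Since `‖u‖² + σ² = 1`, each `y_i` is still standard
Gaussian, and the planted law differs from the null law only through the covariances `u_j` of `y_i`
with the entries of `A_i`. Hence the conditional planted mean of a polynomial `f` is `E₀ (exp(T_u)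
f)`, where `T_u = ∑ i, ∂_{y_i} ∂_u^{A_i}` is `plantOp u`. By Gaussian integration by parts, `f` is
therefore paired with the terms `T_u*^m 1 / m!` of a formal likelihood ratio
(`IsGaussianFunctional.plantSubst_eq`). No density is needed, so `σ = 0` is covered.

The operators `T_u`, `T_v*` and their commutator obey `sl₂`-type relations, whence `E₀ (T_u*^m 1 ·
T_v*^l 1)` vanishes for `m ≠ l` and equals `m! n(n+1)⋯(n+m-1) ⟨u,v⟩^m` for `m = l`. Averaging over
independent copies `x, x'`, order `m` contributes `n(n+1)⋯(n+m-1)/m! · (1-σ²)^m · E⟨x,x'⟩^{dm}` to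
the squared norm of the low-degree ratio. The rising factorial over `m!` is at most `n^m`. Odd
overlap moments vanish, and even ones are at most `(dD/p)^{dm/2}` by a sub-Gaussian recursion. The
bound on `n` then makes order `m` at most `(δ/2)^m` (`advantage_term_le`).

Summing over `m ≥ 1` gives at most `δ`. For odd `d` the order `m = 1` vanishes, leaving at most
`δ²`. Cauchy–Schwarz yields `√δ` and `δ`, slightly better than claimed. -/

noncomputable section

namespace TensorRegression

open MvPolynomial

/-! ### Derivatives, their Gaussian adjoints and the commutation relations -/

section Operators

variable {τ : Type*}

/-- Partial differentiation as an endomorphism of the space of polynomials. -/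
def partialEnd (c : τ) : Module.End ℝ (MvPolynomial τ ℝ) :=
  (pderiv (R := ℝ) c).toLinearMap

/-- Multiplication by a variable as an endomorphism of the space of polynomials. -/
def mulVar (c : τ) : Module.End ℝ (MvPolynomial τ ℝ) := LinearMap.mulLeft ℝ (X c)

/-- The adjoint of a partial derivative with respect to the standard Gaussian measure. -/
def adjPartial (c : τ) : Module.End ℝ (MvPolynomial τ ℝ) := mulVar c - partialEnd c

@[simp] lemma partialEnd_apply (c : τ) (Q : MvPolynomial τ ℝ) : partialEnd c Q = pderiv c Q := rfl

@[simp] lemma mulVar_apply (c : τ) (Q : MvPolynomial τ ℝ) : mulVar c Q = X c * Q := rfl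

lemma pderiv_pderiv_comm (c c' : τ) (Q : MvPolynomial τ ℝ) :
    pderiv c (pderiv c' Q) = pderiv c' (pderiv c Q) := by
  classical
  have h : ⁅pderiv (R := ℝ) c, pderiv (R := ℝ) c'⁆ = 0 := by
    apply derivation_ext
    intro i
    simp only [Derivation.commutator_apply, pderiv_X, Pi.single_apply, Derivation.coe_zero,
      Pi.zero_apply]
    split_ifs <;> simp
  have := congrArg (fun d => d Q) h
  simpa [Derivation.commutator_apply, sub_eq_zero] using this

lemma partialEnd_comm (c c' : τ) :
    partialEnd c * partialEnd c' = partialEnd c' * partialEnd c :=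
  LinearMap.ext fun Q => pderiv_pderiv_comm c c' Q

lemma partialEnd_mulVar [DecidableEq τ] (c c' : τ) :
    partialEnd c * mulVar c' = mulVar c' * partialEnd c + if c = c' then 1 else 0 := by
  refine LinearMap.ext fun Q => ?_
  simp only [Module.End.mul_apply, partialEnd_apply, mulVar_apply, pderiv_mul, LinearMap.add_apply,
    pderiv_X, Pi.single_apply, eq_comm (a := c')]
  split_ifs <;> simp [add_comm]

/-- The canonical commutation relation of annihilation and creation operators, the source of the
`sl₂` relations below. -/
lemma partialEnd_adjPartial [DecidableEq τ] (c c' : τ) :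
    partialEnd c * adjPartial c' = adjPartial c' * partialEnd c + if c = c' then 1 else 0 := by
  rw [adjPartial, mul_sub, sub_mul, partialEnd_mulVar, partialEnd_comm c c']
  abel

lemma adjPartial_comm (c c' : τ) :
    adjPartial c * adjPartial c' = adjPartial c' * adjPartial c := by
  classical
  have h : mulVar c * mulVar c' = mulVar c' * mulVar c :=
    LinearMap.ext fun Q => mul_left_comm (X c) (X c') Q
  simp only [adjPartial, mul_sub, sub_mul, partialEnd_mulVar, partialEnd_comm c c', h,
    eq_comm (a := c')]
  abel

/-- A linear functional on polynomials that satisfies Stein's identities: the expectation under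
the standard Gaussian measure. -/
structure IsGaussianFunctional (E : MvPolynomial τ ℝ →ₗ[ℝ] ℝ) : Prop where
  one : E 1 = 1
  stein : ∀ c Q, E (X c * Q) = E (pderiv c Q)

/-- Stein's identity for the product `g * f`, combined with the Leibniz rule. -/
lemma IsGaussianFunctional.adjPartial_mul {E : MvPolynomial τ ℝ →ₗ[ℝ] ℝ}
    (hE : IsGaussianFunctional E) (c : τ) (g f : MvPolynomial τ ℝ) :
    E (adjPartial c g * f) = E (g * pderiv c f) := by
  have h := hE.stein c (g * f)
  rw [pderiv_mul, map_add] at h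
  simp only [adjPartial, LinearMap.sub_apply, mulVar_apply, partialEnd_apply, sub_mul, map_sub,
    mul_assoc]
  linarith

lemma totalDegree_pderiv_le (c : τ) {Q : MvPolynomial τ ℝ} {N : ℕ} (hQ : Q.totalDegree ≤ N) :
    (pderiv c Q).totalDegree ≤ N := by
  classical
  refine Finset.sup_le fun s hs => ?_
  rw [mem_support_iff, coeff_pderiv] at hs
  have h := le_totalDegree (mem_support_iff.2 (left_ne_zero_of_mul hs))
  rw [Finsupp.sum_add_index' (by simp) (by simp)] at h
  omega

end Operators

/-! ### The planting operator and its `sl₂` structure -/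

section Planting

variable {ι κ : Type*} [Fintype κ]

/-- The derivative in the direction `u` of the covariates of sample `i`. -/
def dirPartial (u : κ → ℝ) (i : ι) : Module.End ℝ (MvPolynomial (ι × Option κ) ℝ) :=
  ∑ j, u j • partialEnd (i, some j)

/-- The Gaussian adjoint of `dirPartial`. -/
def adjDirPartial (u : κ → ℝ) (i : ι) : Module.End ℝ (MvPolynomial (ι × Option κ) ℝ) :=
  ∑ j, u j • adjPartial (i, some j)

variable [Fintype ι]

/-- The operator `∑ i, ∂_{y_i} ∂_u^{A_i}`, whose exponential plants the signal `u`. -/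
def plantOp (u : κ → ℝ) : Module.End ℝ (MvPolynomial (ι × Option κ) ℝ) :=
  ∑ i, partialEnd (i, none) * dirPartial u i

/-- The Gaussian adjoint of `plantOp`. -/
def adjPlantOp (u : κ → ℝ) : Module.End ℝ (MvPolynomial (ι × Option κ) ℝ) :=
  ∑ i, adjPartial (i, none) * adjDirPartial u i

omit [Fintype ι] in
lemma partialEnd_dirPartial_comm (c : ι × Option κ) (u : κ → ℝ) (i : ι) :
    partialEnd c * dirPartial u i = dirPartial u i * partialEnd c := by
  simp only [dirPartial, Finset.mul_sum, Finset.sum_mul, mul_smul_comm, smul_mul_assoc,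
    partialEnd_comm c]

lemma partialEnd_plantOp_comm (c : ι × Option κ) (u : κ → ℝ) :
    partialEnd c * plantOp u = plantOp u * partialEnd c := by
  simp only [plantOp, Finset.mul_sum, Finset.sum_mul]
  refine Finset.sum_congr rfl fun i _ => ?_
  rw [← mul_assoc, partialEnd_comm c, mul_assoc, partialEnd_dirPartial_comm, mul_assoc]

lemma dirPartial_plantOp_comm (u : κ → ℝ) (i : ι) :
    dirPartial u i * plantOp u = plantOp u * dirPartial u i := by
  simp only [dirPartial, Finset.mul_sum, Finset.sum_mul, mul_smul_comm, smul_mul_assoc,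
    partialEnd_plantOp_comm]

variable [DecidableEq ι] [DecidableEq κ]

omit [Fintype ι] [Fintype κ] in
lemma partialEnd_none_adjPartial_some (i k : ι) (j : κ) :
    partialEnd (i, none) * adjPartial (k, some j) = adjPartial (k, some j) * partialEnd (i, none) := by
  simp [partialEnd_adjPartial]

omit [Fintype ι] in
lemma partialEnd_none_adjDirPartial (u : κ → ℝ) (i k : ι) :
    partialEnd (i, none) * adjDirPartial u k = adjDirPartial u k * partialEnd (i, none) := by
  simp only [adjDirPartial, Finset.mul_sum, Finset.sum_mul, mul_smul_comm, smul_mul_assoc,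
    partialEnd_none_adjPartial_some]

omit [Fintype ι] in
lemma dirPartial_adjPartial_none (u : κ → ℝ) (i k : ι) :
    dirPartial u i * adjPartial (k, none) = adjPartial (k, none) * dirPartial u i := by
  simp [dirPartial, Finset.mul_sum, Finset.sum_mul, partialEnd_adjPartial]

omit [Fintype ι] in
lemma dirPartial_adjDirPartial (u v : κ → ℝ) (i k : ι) :
    dirPartial u i * adjDirPartial v k =
      adjDirPartial v k * dirPartial u i + if i = k then (∑ j, u j * v j) • 1 else 0 := by
  have h (j : κ) : partialEnd (i, some j) * adjDirPartial v k =
      adjDirPartial v k * partialEnd (i, some j) + if i = k then v j • 1 else 0 := by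
    have h' (j' : κ) : partialEnd (i, some j) * (v j' • adjPartial (k, some j')) =
        v j' • adjPartial (k, some j') * partialEnd (i, some j) +
          if j = j' then (if i = k then v j' • 1 else 0) else 0 := by
      rw [mul_smul_comm, partialEnd_adjPartial, smul_add, smul_mul_assoc]
      by_cases h1 : j = j' <;> by_cases h2 : i = k <;> simp [h1, h2]
    simp only [adjDirPartial, Finset.mul_sum, Finset.sum_mul, h', Finset.sum_add_distrib,
      Finset.sum_ite_eq, Finset.mem_univ, if_true]
  have h' (j : κ) : u j • partialEnd (i, some j) * adjDirPartial v k =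
      adjDirPartial v k * (u j • partialEnd (i, some j)) +
        if i = k then (u j * v j) • 1 else 0 := by
    rw [smul_mul_assoc, h, smul_add, mul_smul_comm]
    by_cases h2 : i = k <;> simp [h2, smul_smul]
  rw [dirPartial, Finset.sum_mul, Finset.mul_sum, Finset.sum_congr rfl fun j _ => h' j,
    Finset.sum_add_distrib]
  by_cases h2 : i = k <;> simp [h2, Finset.sum_smul]

lemma partialEnd_none_adjPlantOp (v : κ → ℝ) (i : ι) :
    partialEnd (i, none) * adjPlantOp v =
      adjPlantOp v * partialEnd (i, none) + adjDirPartial v i := by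
  have h (k : ι) : partialEnd (i, none) * (adjPartial (k, none) * adjDirPartial v k) =
      adjPartial (k, none) * adjDirPartial v k * partialEnd (i, none) +
        if i = k then adjDirPartial v k else 0 := by
    rw [← mul_assoc, partialEnd_adjPartial, add_mul, mul_assoc, partialEnd_none_adjDirPartial,
      ← mul_assoc]
    simp
  simp [adjPlantOp, Finset.mul_sum, Finset.sum_mul, h, Finset.sum_add_distrib]

lemma dirPartial_adjPlantOp (u v : κ → ℝ) (i : ι) :
    dirPartial u i * adjPlantOp v =
      adjPlantOp v * dirPartial u i + (∑ j, u j * v j) • adjPartial (i, none) := by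
  have h (k : ι) : dirPartial u i * (adjPartial (k, none) * adjDirPartial v k) =
      adjPartial (k, none) * adjDirPartial v k * dirPartial u i +
        if i = k then (∑ j, u j * v j) • adjPartial (k, none) else 0 := by
    rw [← mul_assoc, dirPartial_adjPartial_none, mul_assoc, dirPartial_adjDirPartial, mul_add,
      ← mul_assoc]
    congr 1
    split_ifs <;> simp
  simp [adjPlantOp, Finset.mul_sum, Finset.sum_mul, h, Finset.sum_add_distrib]

/-- The number operator that arises as the commutator of `plantOp` and `adjPlantOp`. -/
def numberOp (u v : κ → ℝ) : Module.End ℝ (MvPolynomial (ι × Option κ) ℝ) :=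
  ∑ i, ((∑ j, u j * v j) • (adjPartial (i, none) * partialEnd (i, none)) +
    adjDirPartial v i * dirPartial u i)

/-- Contracting one of the two factors in a sample leaves a term of `numberOp`. Contracting both
leaves the scalar `⟨u,v⟩`, once per sample. -/
lemma plantOp_adjPlantOp (u v : κ → ℝ) :
    plantOp (ι := ι) u * adjPlantOp v =
      adjPlantOp v * plantOp u + numberOp u v +
        ((∑ j, u j * v j) * Fintype.card ι) • 1 := by
  have h (i : ι) : partialEnd (i, none) * dirPartial u i * adjPlantOp v =
      adjPlantOp v * (partialEnd (i, none) * dirPartial u i) +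
      ((∑ j, u j * v j) • (adjPartial (i, none) * partialEnd (i, none)) +
        adjDirPartial v i * dirPartial u i) + (∑ j, u j * v j) • 1 := by
    rw [mul_assoc, dirPartial_adjPlantOp, mul_add, ← mul_assoc, partialEnd_none_adjPlantOp,
      mul_smul_comm, partialEnd_adjPartial, if_pos rfl, add_mul, smul_add, mul_assoc]
    abel
  rw [numberOp, plantOp]
  generalize ∑ j, u j * v j = ρ at h ⊢
  simp only [Finset.sum_mul, h, Finset.sum_add_distrib, Finset.mul_sum]
  simp only [Finset.sum_const, Finset.card_univ, ← Nat.cast_smul_eq_nsmul ℝ, smul_smul]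
  rw [mul_comm (Fintype.card ι : ℝ)]

omit [DecidableEq ι] [DecidableEq κ] in
lemma adjPartial_adjPlantOp_comm (c : ι × Option κ) (v : κ → ℝ) :
    adjPartial c * adjPlantOp v = adjPlantOp v * adjPartial c := by
  have h (i : ι) : adjPartial c * adjDirPartial v i = adjDirPartial v i * adjPartial c := by
    simp only [adjDirPartial, Finset.mul_sum, Finset.sum_mul, mul_smul_comm, smul_mul_assoc,
      adjPartial_comm c]
  simp only [adjPlantOp, Finset.mul_sum, Finset.sum_mul]
  refine Finset.sum_congr rfl fun i _ => ?_
  rw [← mul_assoc, adjPartial_comm c, mul_assoc, h, mul_assoc]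

omit [DecidableEq ι] [DecidableEq κ] in
lemma adjDirPartial_adjPlantOp_comm (v : κ → ℝ) (i : ι) :
    adjDirPartial v i * adjPlantOp v = adjPlantOp v * adjDirPartial v i := by
  simp only [adjDirPartial, Finset.mul_sum, Finset.sum_mul, mul_smul_comm, smul_mul_assoc,
    adjPartial_adjPlantOp_comm]

omit [Fintype ι] [DecidableEq ι] [DecidableEq κ] in
lemma adjDirPartial_adjPartial_comm (v : κ → ℝ) (i : ι) (c : ι × Option κ) :
    adjDirPartial v i * adjPartial c = adjPartial c * adjDirPartial v i := by
  simp only [adjDirPartial, Finset.mul_sum, Finset.sum_mul, mul_smul_comm, smul_mul_assoc,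
    adjPartial_comm c]

/-- `adjPlantOp v` creates one response factor and one covariate factor. Each raises `numberOp` by
`⟨u,v⟩`, which explains the factor 2. -/
lemma numberOp_adjPlantOp (u v : κ → ℝ) :
    numberOp (ι := ι) u v * adjPlantOp v =
      adjPlantOp v * numberOp u v + (2 * ∑ j, u j * v j) • adjPlantOp v := by
  have h (i : ι) : ((∑ j, u j * v j) • (adjPartial (i, none) * partialEnd (i, none)) +
      adjDirPartial v i * dirPartial u i) * adjPlantOp v =
      adjPlantOp v * ((∑ j, u j * v j) • (adjPartial (i, none) * partialEnd (i, none)) +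
        adjDirPartial v i * dirPartial u i) +
        (2 * ∑ j, u j * v j) • (adjPartial (i, none) * adjDirPartial v i) := by
    rw [add_mul, smul_mul_assoc, mul_assoc, partialEnd_none_adjPlantOp, mul_assoc,
      dirPartial_adjPlantOp, mul_add, mul_add, mul_add, ← mul_assoc, ← mul_assoc,
      adjPartial_adjPlantOp_comm, adjDirPartial_adjPlantOp_comm, mul_smul_comm, mul_smul_comm,
      adjDirPartial_adjPartial_comm, smul_add, two_mul, add_smul, mul_assoc, mul_assoc]
    abel
  rw [numberOp]
  generalize ∑ j, u j * v j = ρ at h ⊢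
  rw [Finset.sum_mul, Finset.sum_congr rfl fun i _ => h i, Finset.sum_add_distrib,
    ← Finset.mul_sum, ← Finset.smul_sum, ← adjPlantOp]

/-- The polynomials `adjPlantOp v ^ m 1` are lowered by `plantOp u` as in a lowest weight
representation of `sl₂`. -/
lemma plantOp_adjPlantOp_pow_succ (u v : κ → ℝ) (m : ℕ) :
    plantOp (ι := ι) u ((adjPlantOp v ^ (m + 1)) 1) =
      ((∑ j, u j * v j) * ((m + 1) * (Fintype.card ι + m))) • (adjPlantOp v ^ m) 1 := by
  have hN (m : ℕ) : numberOp (ι := ι) u v ((adjPlantOp v ^ m) 1) =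
      (2 * (∑ j, u j * v j) * m) • (adjPlantOp v ^ m) 1 := by
    induction m with
    | zero => simp [numberOp, dirPartial]
    | succ m ih =>
      rw [pow_succ', Module.End.mul_apply, ← Module.End.mul_apply, numberOp_adjPlantOp]
      simp only [LinearMap.add_apply, Module.End.mul_apply, LinearMap.smul_apply, ih, map_smul,
        ← add_smul]
      congr 1
      push_cast
      ring
  induction m with
  | zero =>
    rw [pow_succ', Module.End.mul_apply, ← Module.End.mul_apply, plantOp_adjPlantOp]
    simp only [LinearMap.add_apply, Module.End.mul_apply, LinearMap.smul_apply, hN]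
    simp [plantOp, dirPartial]
  | succ m ih =>
    rw [pow_succ', Module.End.mul_apply, ← Module.End.mul_apply, plantOp_adjPlantOp]
    simp only [LinearMap.add_apply, Module.End.mul_apply, LinearMap.smul_apply, hN, ih, map_smul]
    rw [← Module.End.mul_apply, ← pow_succ', Module.End.one_apply, ← add_smul, ← add_smul]
    -- With `n` samples, the coefficients satisfy `(m+1)(n+m) + 2(m+1) + n = (m+2)(n+m+1)`.
    congr 1
    push_cast
    ring

omit [DecidableEq ι] [DecidableEq κ] in
lemma plantOp_one (u : κ → ℝ) : plantOp (ι := ι) u 1 = 0 := by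
  simp [plantOp, dirPartial]

omit [DecidableEq ι] [DecidableEq κ] in
lemma IsGaussianFunctional.adjPlantOp_mul {E : MvPolynomial (ι × Option κ) ℝ →ₗ[ℝ] ℝ}
    (hE : IsGaussianFunctional E) (u : κ → ℝ) (g f : MvPolynomial (ι × Option κ) ℝ) :
    E (adjPlantOp u g * f) = E (g * plantOp u f) := by
  have h (i : ι) (g f : MvPolynomial (ι × Option κ) ℝ) :
      E (adjDirPartial u i g * f) = E (g * dirPartial u i f) := by
    simp [adjDirPartial, dirPartial, Finset.sum_mul, Finset.mul_sum, hE.adjPartial_mul]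
  have hc (i : ι) (f : MvPolynomial (ι × Option κ) ℝ) :
      pderiv (i, none) (dirPartial u i f) = dirPartial u i (pderiv (i, none) f) :=
    LinearMap.congr_fun (partialEnd_dirPartial_comm (i, none) u i) f
  simp [adjPlantOp, plantOp, Finset.sum_mul, Finset.mul_sum, hE.adjPartial_mul, h, hc]

omit [DecidableEq ι] [DecidableEq κ] in
lemma IsGaussianFunctional.adjPlantOp_pow_mul {E : MvPolynomial (ι × Option κ) ℝ →ₗ[ℝ] ℝ}
    (hE : IsGaussianFunctional E) (u : κ → ℝ) (m : ℕ) (g f : MvPolynomial (ι × Option κ) ℝ) :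
    E ((adjPlantOp u ^ m) g * f) = E (g * (plantOp u ^ m) f) := by
  induction m generalizing g f with
  | zero => simp
  | succ m ih =>
    rw [pow_succ', Module.End.mul_apply, hE.adjPlantOp_mul, ih, pow_succ, Module.End.mul_apply]

lemma plantOp_pow_adjPlantOp_pow (u v : κ → ℝ) (m : ℕ) :
    (plantOp (ι := ι) u ^ m) ((adjPlantOp v ^ m) 1) =
      C ((m.factorial * (Fintype.card ι).ascFactorial m : ℕ) * (∑ j, u j * v j) ^ m) := by
  induction m with
  | zero => simp
  | succ m ih =>
    rw [pow_succ (plantOp u), Module.End.mul_apply, plantOp_adjPlantOp_pow_succ, map_smul, ih,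
      Nat.factorial_succ, Nat.ascFactorial_succ, smul_eq_C_mul, ← C_mul]
    congr 1
    push_cast
    ring

/-- The first `m` lowerings reach a constant, which the next one annihilates. -/
lemma plantOp_pow_adjPlantOp_pow_of_lt (u v : κ → ℝ) {m l : ℕ} (h : m < l) :
    (plantOp (ι := ι) u ^ l) ((adjPlantOp v ^ m) 1) = 0 := by
  obtain ⟨k, rfl⟩ := Nat.exists_eq_add_of_lt h
  rw [show m + k + 1 = k + 1 + m by ring, pow_add, Module.End.mul_apply,
    plantOp_pow_adjPlantOp_pow, pow_succ, Module.End.mul_apply, ← mul_one (C _),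
    ← smul_eq_C_mul, map_smul, plantOp_one, smul_zero, map_zero]

/-- The Gaussian inner products of the polynomials `adjPlantOp u ^ m 1`. -/
lemma IsGaussianFunctional.adjPlantOp_pow_mul_adjPlantOp_pow
    {E : MvPolynomial (ι × Option κ) ℝ →ₗ[ℝ] ℝ}
    (hE : IsGaussianFunctional E) (u v : κ → ℝ) (m l : ℕ) :
    E ((adjPlantOp u ^ m) 1 * (adjPlantOp v ^ l) 1) =
      if m = l then (m.factorial * (Fintype.card ι).ascFactorial m : ℕ) *
        (∑ j, u j * v j) ^ m else 0 := by
  rcases lt_trichotomy m l with h | rfl | h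
  · rw [if_neg h.ne, mul_comm, hE.adjPlantOp_pow_mul, one_mul,
      plantOp_pow_adjPlantOp_pow_of_lt _ _ h, map_zero]
  · rw [if_pos rfl, hE.adjPlantOp_pow_mul, one_mul, plantOp_pow_adjPlantOp_pow, ← mul_one (C _),
      ← smul_eq_C_mul, map_smul, hE.one, smul_eq_mul, mul_one]
  · rw [if_neg h.ne', hE.adjPlantOp_pow_mul, one_mul,
      plantOp_pow_adjPlantOp_pow_of_lt _ _ h, map_zero]

end Planting

/-! ### The planted expectation as the exponential of the planting operator -/

section PlantedFunctional

variable {ι κ : Type*} [Fintype κ]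

/-- The commutator of `plantOp u` with the multiplication by a variable. -/
def shiftOp (u : κ → ℝ) : ι × Option κ → Module.End ℝ (MvPolynomial (ι × Option κ) ℝ)
  | (i, none) => dirPartial u i
  | (i, some j) => u j • partialEnd (i, none)

lemma totalDegree_shiftOp_le (u : κ → ℝ) (c : ι × Option κ) {Q : MvPolynomial (ι × Option κ) ℝ}
    {N : ℕ} (hQ : Q.totalDegree ≤ N) : (shiftOp u c Q).totalDegree ≤ N := by
  obtain ⟨i, _ | j⟩ := c
  · simp only [shiftOp, dirPartial, LinearMap.sum_apply, LinearMap.smul_apply, partialEnd_apply]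
    exact totalDegree_finsetSum_le fun j _ =>
      (totalDegree_smul_le _ _).trans (totalDegree_pderiv_le _ hQ)
  · exact (totalDegree_smul_le _ _).trans (totalDegree_pderiv_le _ hQ)

variable [Fintype ι]

lemma shiftOp_plantOp_comm (u : κ → ℝ) (c : ι × Option κ) :
    shiftOp u c * plantOp u = plantOp u * shiftOp u c := by
  obtain ⟨i, _ | j⟩ := c
  · exact dirPartial_plantOp_comm u i
  · simp only [shiftOp, smul_mul_assoc, mul_smul_comm, partialEnd_plantOp_comm]

lemma plantOp_mulVar (u : κ → ℝ) (c : ι × Option κ) :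
    plantOp u * mulVar c = mulVar c * plantOp u + shiftOp u c := by
  classical
  have hd (i : ι) : dirPartial u i * mulVar c = mulVar c * dirPartial u i +
      (∑ j, u j • if (i, some j) = c then 1 else 0) := by
    simp only [dirPartial, Finset.mul_sum, Finset.sum_mul, mul_smul_comm, smul_mul_assoc,
      partialEnd_mulVar, smul_add, Finset.sum_add_distrib]
  have h (i : ι) : partialEnd (i, none) * dirPartial u i * mulVar c =
      mulVar c * (partialEnd (i, none) * dirPartial u i) +
        ((if (i, none) = c then dirPartial u i else 0) +
        ∑ j, u j • if (i, some j) = c then partialEnd (i, none) else 0) := by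
    rw [mul_assoc, hd, mul_add, ← mul_assoc, partialEnd_mulVar, add_mul, mul_assoc, add_assoc]
    congr 2
    · split_ifs <;> simp
    · rw [Finset.mul_sum]
      refine Finset.sum_congr rfl fun j _ => ?_
      rw [mul_smul_comm]
      split_ifs <;> simp
  simp only [plantOp, Finset.sum_mul, h, Finset.sum_add_distrib, Finset.mul_sum]
  congr 1
  obtain ⟨k, _ | j⟩ := c
  · simp [shiftOp]
  · simp [shiftOp, ite_and]

/-- `shiftOp u c` commutes with `plantOp u`, so no higher commutators appear. Divided by `(m+1)!`,
this is the coefficientwise form of `[exp T, X_c] = exp T · shiftOp`. -/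
lemma plantOp_pow_mulVar (u : κ → ℝ) (c : ι × Option κ) (m : ℕ) :
    plantOp u ^ (m + 1) * mulVar c =
      mulVar c * plantOp u ^ (m + 1) + ((m : ℝ) + 1) • (plantOp u ^ m * shiftOp u c) := by
  induction m with
  | zero => simp [plantOp_mulVar]
  | succ m ih =>
    have hs : plantOp u ^ (m + 1) * shiftOp u c = plantOp u * (plantOp u ^ m * shiftOp u c) := by
      rw [pow_succ', mul_assoc]
    have hs' : shiftOp u c * plantOp u ^ (m + 1) = plantOp u ^ (m + 1) * shiftOp u c :=
      (Commute.pow_right (shiftOp_plantOp_comm u c) (m + 1) :)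
    rw [pow_succ' _ (m + 1), mul_assoc, ih, mul_add, ← mul_assoc, plantOp_mulVar, add_mul,
      mul_assoc, mul_smul_comm, ← hs, hs', add_assoc]
    congr 1
    push_cast
    module

variable {E F : MvPolynomial (ι × Option κ) ℝ →ₗ[ℝ] ℝ}

lemma IsGaussianFunctional.sum_plantOp_pow_X_mul (hE : IsGaussianFunctional E) (u : κ → ℝ)
    (c : ι × Option κ) (Q : MvPolynomial (ι × Option κ) ℝ) (K : ℕ) :
    ∑ m ∈ Finset.range (K + 2), (m.factorial : ℝ)⁻¹ * E ((plantOp u ^ m) (X c * Q)) =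
      ∑ m ∈ Finset.range (K + 2), (m.factorial : ℝ)⁻¹ * E ((plantOp u ^ m) (pderiv c Q)) +
      ∑ m ∈ Finset.range (K + 1), (m.factorial : ℝ)⁻¹ * E ((plantOp u ^ m) (shiftOp u c Q)) := by
  have hc (m : ℕ) : pderiv c ((plantOp u ^ m) Q) = (plantOp u ^ m) (pderiv c Q) :=
    LinearMap.congr_fun
      (Commute.pow_right (partialEnd_plantOp_comm c u) m : partialEnd c * plantOp u ^ m = _) Q
  have h (m : ℕ) : E ((plantOp u ^ (m + 1)) (X c * Q)) =
      E ((plantOp u ^ (m + 1)) (pderiv c Q)) +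
        ((m : ℝ) + 1) * E ((plantOp u ^ m) (shiftOp u c Q)) := by
    have := LinearMap.congr_fun (plantOp_pow_mulVar u c m) Q
    simp only [Module.End.mul_apply, mulVar_apply, LinearMap.add_apply, LinearMap.smul_apply] at this
    rw [this, map_add, hE.stein, hc, map_smul, smul_eq_mul]
  -- The shift term at order `m` comes from order `m + 1`, so its sum is one term shorter.
  rw [Finset.sum_range_succ' _ (K + 1), Finset.sum_range_succ' _ (K + 1)]
  simp only [h, mul_add, Finset.sum_add_distrib, pow_zero, Module.End.one_apply, hE.stein]
  rw [add_right_comm]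
  congr 1
  refine Finset.sum_congr rfl fun m _ => ?_
  rw [Nat.factorial_succ, ← mul_assoc]
  congr 1
  push_cast
  field_simp

/-- A functional that satisfies the Stein identities of the planted Gaussian law is the exponential
of `plantOp` composed with the standard Gaussian expectation. -/
lemma IsGaussianFunctional.planted_eq (hE : IsGaussianFunctional E) (u : κ → ℝ) (hF1 : F 1 = 1)
    (hF : ∀ c Q, F (X c * Q) = F (pderiv c Q) + F (shiftOp u c Q)) {K : ℕ}
    {f : MvPolynomial (ι × Option κ) ℝ} (hf : f.totalDegree ≤ K) :
    F f = ∑ m ∈ Finset.range (K + 1), (m.factorial : ℝ)⁻¹ * E ((plantOp u ^ m) f) := by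
  have hconst (a : ℝ) (K : ℕ) :
      F (C a) = ∑ m ∈ Finset.range (K + 1), (m.factorial : ℝ)⁻¹ * E ((plantOp u ^ m) (C a)) := by
    have h0 (m : ℕ) : (plantOp (ι := ι) u ^ (m + 1)) (C a) = 0 := by
      rw [pow_succ, Module.End.mul_apply, ← mul_one (C a), ← smul_eq_C_mul, map_smul, plantOp_one,
        smul_zero, map_zero]
    rw [Finset.sum_range_succ']
    simp only [h0, map_zero, mul_zero, Finset.sum_const_zero, zero_add, pow_zero,
      Module.End.one_apply, Nat.factorial_zero, Nat.cast_one, inv_one, one_mul]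
    rw [← mul_one (C a), ← smul_eq_C_mul, map_smul, map_smul, hF1, hE.one]
  -- The truncation order is decoupled from the degree: peeling off a variable lowers the degree
  -- bound by one but needs the induction hypothesis at the two truncations `K` and `K + 1`.
  suffices H : ∀ N, ∀ f : MvPolynomial (ι × Option κ) ℝ, f.totalDegree ≤ N → ∀ K, N ≤ K →
      F f = ∑ m ∈ Finset.range (K + 1), (m.factorial : ℝ)⁻¹ * E ((plantOp u ^ m) f) from
    H K f hf K le_rfl
  intro N
  induction N with
  | zero =>
    intro f hf K _
    rw [totalDegree_eq_zero_iff_eq_C.1 (Nat.le_zero.1 hf)]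
    exact hconst _ K
  | succ N ih =>
    intro f hf K hK
    obtain ⟨K, rfl⟩ : ∃ K', K = K' + 1 := ⟨K - 1, by omega⟩
    have hmon (s) (hs : s ∈ f.support) : F (monomial s (coeff s f)) =
        ∑ m ∈ Finset.range (K + 2), (m.factorial : ℝ)⁻¹ *
          E ((plantOp u ^ m) (monomial s (coeff s f))) := by
      have hdeg := (le_totalDegree hs).trans hf
      generalize coeff s f = a
      by_cases h0 : s = 0
      · subst h0
        exact hconst a (K + 1)
      obtain ⟨c, hc⟩ := Finsupp.ne_iff.1 h0
      have hs' : s = Finsupp.single c 1 + (s - Finsupp.single c 1) := by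
        rw [add_tsub_cancel_of_le]
        rw [Finsupp.single_le_iff]
        exact Nat.one_le_iff_ne_zero.2 hc
      generalize s - Finsupp.single c 1 = t at hs'
      subst hs'
      have ht : (monomial t a).totalDegree ≤ N := by
        refine (totalDegree_monomial_le _ _).trans ?_
        rw [Finsupp.sum_add_index' (by simp) (by simp), Finsupp.sum_single_index rfl] at hdeg
        have : (t.sum fun _ => id) = t.sum fun _ e => e := rfl
        omega
      rw [show monomial (Finsupp.single c 1 + t) a = X c * monomial t a by
        rw [X, monomial_mul, one_mul], hF, hE.sum_plantOp_pow_X_mul,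
        ih _ (totalDegree_pderiv_le c ht) (K + 1) (by omega),
        ih _ (totalDegree_shiftOp_le u c ht) K (by omega)]
    conv_lhs => rw [f.as_sum, map_sum, Finset.sum_congr rfl hmon]
    rw [Finset.sum_comm]
    refine Finset.sum_congr rfl fun m _ => ?_
    rw [← Finset.mul_sum, ← map_sum, ← map_sum, ← f.as_sum]

omit [Fintype ι] in
/-- The substitution `y_i ↦ ⟨u, A_i⟩ + σ y_i`. -/
def plantSubst (u : κ → ℝ) (σ : ℝ) :
    MvPolynomial (ι × Option κ) ℝ →ₐ[ℝ] MvPolynomial (ι × Option κ) ℝ :=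
  aeval fun c => match c with
    | (i, none) => ∑ j, u j • X (i, some j) + σ • X (i, none)
    | (i, some j) => X (i, some j)

omit [Fintype ι] in
lemma plantSubst_X_none (u : κ → ℝ) (σ : ℝ) (i : ι) :
    plantSubst u σ (X (i, none)) = ∑ j, u j • X (i, some j) + σ • X (i, none) := by
  simp [plantSubst]

omit [Fintype ι] in
lemma plantSubst_X_some (u : κ → ℝ) (σ : ℝ) (i : ι) (j : κ) :
    plantSubst u σ (X (i, some j)) = X (i, some j) := by
  simp [plantSubst]

omit [Fintype ι] in
lemma pderiv_plantSubst_none (u : κ → ℝ) (σ : ℝ) (i : ι) (Q : MvPolynomial (ι × Option κ) ℝ) :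
    pderiv (i, none) (plantSubst u σ Q) = σ • plantSubst u σ (pderiv (i, none) Q) := by
  classical
  induction Q using MvPolynomial.induction_on with
  | C a => simp [plantSubst]
  | add p q hp hq => simp [hp, hq]
  | mul_X p c h =>
    rw [map_mul, pderiv_mul, h, pderiv_mul, map_add, map_mul, map_mul, smul_add, smul_mul_assoc]
    congr 1
    rw [← mul_smul_comm]
    congr 1
    obtain ⟨k, _ | j⟩ := c
    · rw [plantSubst_X_none]
      by_cases hk : k = i <;> simp [pderiv_X, hk]
    · rw [plantSubst_X_some]
      simp [pderiv_X]

omit [Fintype ι] in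
lemma pderiv_plantSubst_some (u : κ → ℝ) (σ : ℝ) (i : ι) (j : κ)
    (Q : MvPolynomial (ι × Option κ) ℝ) :
    pderiv (i, some j) (plantSubst u σ Q) =
      plantSubst u σ (pderiv (i, some j) Q + u j • pderiv (i, none) Q) := by
  classical
  induction Q using MvPolynomial.induction_on with
  | C a => simp [plantSubst]
  | add p q hp hq =>
    simp only [map_add, hp, hq, smul_add]
    abel
  | mul_X p c h =>
    have hX : pderiv (i, some j) (plantSubst u σ (X c)) =
        plantSubst u σ (pderiv (i, some j) (X c) + u j • pderiv (i, none) (X c)) := by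
      obtain ⟨k, _ | j'⟩ := c
      · rw [plantSubst_X_none]
        by_cases hk : k = i <;> simp [pderiv_X, Pi.single_apply, hk]
      · rw [plantSubst_X_some]
        by_cases hk : k = i <;> by_cases hj : j' = j <;> simp [pderiv_X, hk, hj]
    rw [map_mul, pderiv_mul, h, hX, ← map_mul, ← map_mul, ← map_add, pderiv_mul, pderiv_mul]
    congr 1
    simp only [add_mul, mul_add, smul_add, smul_mul_assoc, mul_smul_comm]
    abel

omit [Fintype ι] in
/-- The Stein identities of the planted Gaussian law. -/
lemma IsGaussianFunctional.plantSubst_stein (hE : IsGaussianFunctional E) {u : κ → ℝ} {σ : ℝ}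
    (hu : ∑ j, u j ^ 2 + σ ^ 2 = 1) (c : ι × Option κ) (Q : MvPolynomial (ι × Option κ) ℝ) :
    E (plantSubst u σ (X c * Q)) =
      E (plantSubst u σ (pderiv c Q)) + E (plantSubst u σ (shiftOp u c Q)) := by
  obtain ⟨i, _ | j⟩ := c
  · rw [map_mul, plantSubst_X_none, add_mul, map_add, Finset.sum_mul, smul_mul_assoc, map_smul,
      hE.stein, pderiv_plantSubst_none, map_sum]
    simp only [smul_mul_assoc, map_smul, hE.stein, pderiv_plantSubst_some, map_add, shiftOp,
      dirPartial, LinearMap.sum_apply, LinearMap.smul_apply, map_sum, partialEnd_apply,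
      smul_eq_mul, mul_add, Finset.sum_add_distrib]
    simp only [← mul_assoc, ← Finset.sum_mul, ← pow_two]
    -- The response contributes its variance `‖u‖² + σ²` as coefficient of the `y_i`-derivative;
    -- `hu` says that it is 1.
    linear_combination E (plantSubst u σ (pderiv (i, none) Q)) * hu
  · rw [map_mul, plantSubst_X_some, hE.stein, pderiv_plantSubst_some, map_add, map_add]
    rfl

/-- The planted expectation of a polynomial, expanded in the strength of the signal. -/
lemma IsGaussianFunctional.plantSubst_eq (hE : IsGaussianFunctional E) {u : κ → ℝ} {σ : ℝ}
    (hu : ∑ j, u j ^ 2 + σ ^ 2 = 1) {K : ℕ} {f : MvPolynomial (ι × Option κ) ℝ}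
    (hf : f.totalDegree ≤ K) :
    E (plantSubst u σ f) =
      ∑ m ∈ Finset.range (K + 1), (m.factorial : ℝ)⁻¹ * E ((adjPlantOp u ^ m) 1 * f) := by
  have := hE.planted_eq (F := E ∘ₗ (plantSubst u σ).toLinearMap) u
    (by simp [hE.one]) (hE.plantSubst_stein hu) hf
  simpa [hE.adjPlantOp_pow_mul] using this

end PlantedFunctional

/-! ### Moments of sums of random signs and the bound at each order -/

section SignMoments

lemma two_mul_sum_pow_mul_pow_le (a b : ℝ) (r : ℕ) :
    2 * ∑ i ∈ Finset.range (2 * r + 1), a ^ i * b ^ (2 * r - i) ≤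
      (2 * r + 1) * (a ^ (2 * r) + b ^ (2 * r)) := by
  have hrefl : ∑ i ∈ Finset.range (2 * r + 1), a ^ i * b ^ (2 * r - i) =
      ∑ i ∈ Finset.range (2 * r + 1), a ^ (2 * r - i) * b ^ i := by
    rw [← Finset.sum_range_reflect]
    refine Finset.sum_congr rfl fun i hi => ?_
    have := Finset.mem_range.1 hi
    congr 2
    omega
  have hterm (i : ℕ) (hi : i ∈ Finset.range (2 * r + 1)) :
      a ^ i * b ^ (2 * r - i) + a ^ (2 * r - i) * b ^ i ≤ a ^ (2 * r) + b ^ (2 * r) := by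
    have hi' : i + (2 * r - i) = 2 * r := by
      have := Finset.mem_range.1 hi
      omega
    have h1 : |a| ^ (2 * r) = a ^ (2 * r) := (even_two_mul r).pow_abs a
    have h2 : |b| ^ (2 * r) = b ^ (2 * r) := (even_two_mul r).pow_abs b
    generalize 2 * r - i = j at *
    rw [← h1, ← h2, ← hi', pow_add, pow_add]
    have h3 : a ^ i * b ^ j ≤ |a| ^ i * |b| ^ j := by
      rw [← abs_pow, ← abs_pow, ← abs_mul]; exact le_abs_self _
    have h4 : a ^ j * b ^ i ≤ |a| ^ j * |b| ^ i := by
      rw [← abs_pow, ← abs_pow, ← abs_mul]; exact le_abs_self _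
    -- Rearrangement: both factors have the sign of `|a| - |b|`.
    have h5 : 0 ≤ (|a| ^ i - |b| ^ i) * (|a| ^ j - |b| ^ j) := by
      rcases le_total |a| |b| with h | h
      · exact mul_nonneg_of_nonpos_of_nonpos
          (sub_nonpos.2 (pow_le_pow_left₀ (abs_nonneg a) h i))
          (sub_nonpos.2 (pow_le_pow_left₀ (abs_nonneg a) h j))
      · exact mul_nonneg (sub_nonneg.2 (pow_le_pow_left₀ (abs_nonneg b) h i))
          (sub_nonneg.2 (pow_le_pow_left₀ (abs_nonneg b) h j))
    linarith
  calc 2 * ∑ i ∈ Finset.range (2 * r + 1), a ^ i * b ^ (2 * r - i)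
      = ∑ i ∈ Finset.range (2 * r + 1),
          (a ^ i * b ^ (2 * r - i) + a ^ (2 * r - i) * b ^ i) := by
        rw [Finset.sum_add_distrib, ← hrefl, two_mul]
    _ ≤ ∑ i ∈ Finset.range (2 * r + 1), (a ^ (2 * r) + b ^ (2 * r)) := Finset.sum_le_sum hterm
    _ = _ := by
      rw [Finset.sum_const, Finset.card_range, nsmul_eq_mul]
      push_cast
      rfl

lemma sign_mul_pow_sub_pow_le {a b s : ℝ} (hs : s ^ 2 = 1) (hab : a - b = 2 * s) (r : ℕ) :
    s * (a ^ (2 * r + 1) - b ^ (2 * r + 1)) ≤ (2 * r + 1) * (a ^ (2 * r) + b ^ (2 * r)) := by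
  have h := geom_sum₂_mul a b (2 * r + 1)
  rw [hab] at h
  rw [← h]
  calc _ = s ^ 2 * (2 * ∑ i ∈ Finset.range (2 * r + 1), a ^ i * b ^ (2 * r + 1 - 1 - i)) := by ring
    _ ≤ _ := by
      rw [hs, one_mul]
      exact two_mul_sum_pow_mul_pow_le a b r

variable {p : ℕ}

/-- The sum of a vector of signs. -/
def signSum (s : Fin p → ℤˣ) : ℝ := ∑ i, ((s i : ℤ) : ℝ)

lemma sum_signSum_pow_of_odd {q : ℕ} (hq : Odd q) : ∑ s : Fin p → ℤˣ, signSum s ^ q = 0 := by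
  have h : ∑ s : Fin p → ℤˣ, signSum s ^ q = ∑ s : Fin p → ℤˣ, signSum (-s) ^ q :=
    (Equiv.sum_comp (Equiv.neg (Fin p → ℤˣ)) fun s => signSum s ^ q).symm
  have h' (s : Fin p → ℤˣ) : signSum (-s) = -signSum s := by simp [signSum]
  simp only [h', hq.neg_pow, Finset.sum_neg_distrib] at h
  linarith

/-- A discrete integration by parts. Write one factor of `S^{2r+2}` as `∑ s_i`. Flipping the sign
`s_i` turns `S` into `S' = S - 2 s_i`, so the average of `s_i S^{2r+1}` is half that of `s_i
(S^{2r+1} - S'^{2r+1})`, which `sign_mul_pow_sub_pow_le` controls. -/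
lemma sum_signSum_pow_add_two_le (r : ℕ) :
    ∑ s : Fin p → ℤˣ, signSum s ^ (2 * r + 2) ≤
      p * (2 * r + 1) * ∑ s : Fin p → ℤˣ, signSum s ^ (2 * r) := by
  have hi (i : Fin p) : ∑ s : Fin p → ℤˣ, ((s i : ℤ) : ℝ) * signSum s ^ (2 * r + 1) ≤
      (2 * r + 1) * ∑ s : Fin p → ℤˣ, signSum s ^ (2 * r) := by
    let flip : Fin p → ℤˣ := Pi.mulSingle i (-1)
    have hflip (g : (Fin p → ℤˣ) → ℝ) :
        ∑ s : Fin p → ℤˣ, g (s * flip) = ∑ s, g s :=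
      Equiv.sum_comp (Equiv.mulRight flip) g
    have hval (s : Fin p → ℤˣ) :
        signSum (s * flip) = signSum s - 2 * ((s i : ℤ) : ℝ) := by
      have (k : Fin p) : ((((s * flip) k : ℤˣ) : ℤ) : ℝ) =
          ((s k : ℤ) : ℝ) - if k = i then 2 * ((s i : ℤ) : ℝ) else 0 := by
        by_cases hk : k = i
        · subst hk
          simp [flip]
          ring
        · simp [flip, hk]
      simp only [signSum, this, Finset.sum_sub_distrib]
      simp
    have hsgn (s : Fin p → ℤˣ) : ((((s * flip) i : ℤˣ) : ℤ) : ℝ) = -((s i : ℤ) : ℝ) := by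
      simp [flip]
    have h1 := hflip fun s => ((s i : ℤ) : ℝ) * signSum s ^ (2 * r + 1)
    have h2 := hflip fun s => signSum s ^ (2 * r)
    simp only [hsgn, hval] at h1 h2
    have h3 : ∑ s : Fin p → ℤˣ, ((s i : ℤ) : ℝ) * (signSum s ^ (2 * r + 1) -
        (signSum s - 2 * ((s i : ℤ) : ℝ)) ^ (2 * r + 1)) ≤
        ∑ s : Fin p → ℤˣ, (2 * r + 1) *
          (signSum s ^ (2 * r) + (signSum s - 2 * ((s i : ℤ) : ℝ)) ^ (2 * r)) := by
      refine Finset.sum_le_sum fun s _ => sign_mul_pow_sub_pow_le ?_ (by ring) r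
      rcases Int.units_eq_one_or (s i) with h | h <;> simp [h]
    rw [← Finset.mul_sum, Finset.sum_add_distrib, h2] at h3
    simp only [mul_sub, Finset.sum_sub_distrib] at h3
    simp only [neg_mul, Finset.sum_neg_distrib] at h1
    linarith
  calc ∑ s : Fin p → ℤˣ, signSum s ^ (2 * r + 2)
      = ∑ i, ∑ s : Fin p → ℤˣ, ((s i : ℤ) : ℝ) * signSum s ^ (2 * r + 1) := by
        rw [Finset.sum_comm]
        refine Finset.sum_congr rfl fun s _ => ?_
        rw [← Finset.sum_mul, ← signSum]
        ring
    _ ≤ ∑ _i : Fin p, (2 * r + 1) * ∑ s : Fin p → ℤˣ, signSum s ^ (2 * r) :=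
        Finset.sum_le_sum fun i _ => hi i
    _ = _ := by simp [mul_assoc]

lemma sum_signSum_pow_le {r B : ℕ} (hr : 2 * r ≤ B) :
    ∑ s : Fin p → ℤˣ, signSum s ^ (2 * r) ≤ 2 ^ p * ((B : ℝ) * p) ^ r := by
  induction r with
  | zero => simp
  | succ r ih =>
    have hB : (2 * r + 1 : ℝ) ≤ B := by exact_mod_cast (by omega : 2 * r + 1 ≤ B)
    calc _ ≤ p * (2 * r + 1) * ∑ s : Fin p → ℤˣ, signSum s ^ (2 * r) :=
          sum_signSum_pow_add_two_le r
      _ ≤ p * B * (2 ^ p * ((B : ℝ) * p) ^ r) := by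
          refine mul_le_mul (by gcongr) (ih (by omega)) ?_ (by positivity)
          exact Finset.sum_nonneg fun s _ => (even_two_mul r).pow_nonneg _
      _ = _ := by ring

/-- The vector with entries `± p^{-1/2}` given by a vector of signs. -/
def signVector (s : Fin p → ℤˣ) : Fin p → ℝ := fun i => (s i : ℤ) * (√(p : ℝ))⁻¹

lemma sum_signVector_mul_signVector (s t : Fin p → ℤˣ) :
    ∑ i, signVector s i * signVector t i = signSum (s * t) / p := by
  rw [signSum, Finset.sum_div]
  refine Finset.sum_congr rfl fun i _ => ?_
  have h : (√(p : ℝ))⁻¹ * (√(p : ℝ))⁻¹ = (p : ℝ)⁻¹ := by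
    rw [← mul_inv, Real.mul_self_sqrt (Nat.cast_nonneg p)]
  simp only [signVector, Pi.mul_apply, Units.val_mul, Int.cast_mul, div_eq_mul_inv, ← h]
  ring

/-- The moments of the overlap of two independent uniform sign vectors. -/
lemma sum_sum_overlap_pow (q : ℕ) :
    ∑ s : Fin p → ℤˣ, ∑ t : Fin p → ℤˣ, (∑ i, signVector s i * signVector t i) ^ q =
      2 ^ p * (∑ s : Fin p → ℤˣ, signSum s ^ q) / p ^ q := by
  have h (s : Fin p → ℤˣ) : ∑ t : Fin p → ℤˣ, signSum (s * t) ^ q = ∑ t, signSum t ^ q :=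
    Equiv.sum_comp (Equiv.mulLeft s) fun t => signSum t ^ q
  simp only [sum_signVector_mul_signVector, div_pow, ← Finset.sum_div, h]
  simp

lemma sum_plantedTensor_mul (d : ℕ) {σ : ℝ} (hσ : σ ^ 2 ≤ 1) (x y : Fin p → ℝ) :
    ∑ j, plantedTensor d p σ x j * plantedTensor d p σ y j =
      (1 - σ ^ 2) * (∑ i, x i * y i) ^ d := by
  have h : √(1 - σ ^ 2) * √(1 - σ ^ 2) = 1 - σ ^ 2 := Real.mul_self_sqrt (by linarith)
  have h2 : (∑ i, x i * y i) ^ d = ∑ j : Fin d → Fin p, ∏ k, (x (j k) * y (j k)) := by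
    rw [← Fin.prod_const, Finset.prod_univ_sum, Fintype.piFinset_univ]
  rw [h2, Finset.mul_sum, ← h]
  refine Finset.sum_congr rfl fun j _ => ?_
  rw [plantedTensor, plantedTensor, Finset.prod_mul_distrib]
  ring

lemma ascFactorial_le_factorial_mul_pow (n m : ℕ) : n.ascFactorial m ≤ m.factorial * n ^ m := by
  induction m with
  | zero => simp
  | succ m ih =>
    rcases Nat.eq_zero_or_pos n with rfl | hn
    · simp [Nat.zero_ascFactorial]
    rw [Nat.ascFactorial_succ, Nat.factorial_succ, pow_succ]
    calc (n + m) * n.ascFactorial m ≤ ((m + 1) * n) * (m.factorial * n ^ m) :=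
          Nat.mul_le_mul (by nlinarith) ih
      _ = _ := by ring

/-- The contribution of order `m` to the squared low-degree advantage. -/
lemma advantage_term_le {n d p D m : ℕ} (hd : 1 ≤ d) (hp : 1 ≤ p) (hD : 1 ≤ D) (hm : m ≤ D)
    {σ δ : ℝ} (hσ : σ ^ 2 < 1)
    (hn : (n : ℝ) ≤ ((p : ℝ) / ((d : ℝ) * (D : ℝ))) ^ ((d : ℝ) / 2) * δ / (2 * (1 - σ ^ 2))) :
    (m.factorial : ℝ)⁻¹ * n.ascFactorial m * (4 ^ p : ℝ)⁻¹ *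
      ∑ s : Fin p → ℤˣ, ∑ t : Fin p → ℤˣ,
        ((1 - σ ^ 2) * (∑ i, signVector s i * signVector t i) ^ d) ^ m ≤
      if Odd (d * m) then 0 else (δ / 2) ^ m := by
  simp only [mul_pow, ← pow_mul, ← Finset.mul_sum, sum_sum_overlap_pow]
  split_ifs with h
  · simp [sum_signSum_pow_of_odd h]
  obtain ⟨r, hr⟩ := even_iff_two_dvd.1 (Nat.not_odd_iff_even.1 h)
  have hσ' : 0 < 1 - σ ^ 2 := by linarith
  have hp' : (0 : ℝ) < p := by exact_mod_cast hp
  have hdD : (0 : ℝ) < d * D := by exact_mod_cast Nat.mul_pos hd hD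
  have hasc : (m.factorial : ℝ)⁻¹ * n.ascFactorial m ≤ (n : ℝ) ^ m := by
    rw [inv_mul_le_iff₀ (by exact_mod_cast m.factorial_pos)]
    exact_mod_cast ascFactorial_le_factorial_mul_pow n m
  -- Here `2r = dm ≤ dD`, so `B = dD` serves every order `m ≤ D`.
  have hS := sum_signSum_pow_le (p := p) (r := r) (B := d * D)
    (by rw [← hr]; exact Nat.mul_le_mul_left d hm)
  have hpow : (n * (1 - σ ^ 2)) ^ m ≤ ((p : ℝ) / (d * D)) ^ r * (δ / 2) ^ m := by
    have h1 : n * (1 - σ ^ 2) ≤ ((p : ℝ) / (d * D)) ^ ((d : ℝ) / 2) * (δ / 2) := by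
      rw [le_div_iff₀ (by linarith)] at hn
      linarith
    -- As `dm = 2r`, the possibly half-integral exponent becomes the natural number `r`.
    have h2 : (((p : ℝ) / (d * D)) ^ ((d : ℝ) / 2)) ^ m = ((p : ℝ) / (d * D)) ^ r := by
      rw [← Real.rpow_mul_natCast (by positivity), ← Real.rpow_natCast]
      congr 1
      have : (d * m : ℝ) = 2 * r := by exact_mod_cast hr
      linarith
    rw [← h2, ← mul_pow]
    exact pow_le_pow_left₀ (by positivity) h1 m
  rw [hr]
  have h0 : 0 ≤ ∑ s : Fin p → ℤˣ, signSum s ^ (2 * r) :=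
    Finset.sum_nonneg fun s _ => (even_two_mul r).pow_nonneg _
  calc _ = ((m.factorial : ℝ)⁻¹ * n.ascFactorial m) * ((1 - σ ^ 2) ^ m *
          ((4 ^ p : ℝ)⁻¹ * 2 ^ p / p ^ (2 * r)) * ∑ s : Fin p → ℤˣ, signSum s ^ (2 * r)) := by ring
    _ ≤ (n : ℝ) ^ m * ((1 - σ ^ 2) ^ m *
          ((4 ^ p : ℝ)⁻¹ * 2 ^ p / p ^ (2 * r)) * (2 ^ p * (((d * D : ℕ) : ℝ) * p) ^ r)) := by
        gcongr
    _ = (n * (1 - σ ^ 2)) ^ m * (((d * D : ℝ) / p) ^ r) := by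
        have h4 : (4 : ℝ) ^ p = 2 ^ p * 2 ^ p := by rw [← mul_pow]; norm_num
        have hpp : (p : ℝ) ^ (2 * r) = p ^ r * p ^ r := by rw [two_mul, pow_add]
        rw [h4, hpp, mul_pow (n : ℝ), mul_pow _ (p : ℝ), div_pow]
        push_cast
        field_simp
    _ ≤ ((p : ℝ) / (d * D)) ^ r * (δ / 2) ^ m * (((d * D : ℝ) / p) ^ r) := by gcongr
    _ = (δ / 2) ^ m := by
        rw [mul_right_comm, ← mul_pow, div_mul_div_cancel₀ hdD.ne', div_self hp'.ne', one_pow,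
          one_mul]

end SignMoments

/-! ### One-dimensional Gaussian moments -/

section GaussianMoments

lemma integrable_pow_gaussianReal (k : ℕ) : Integrable (fun x : ℝ => x ^ k) (gaussianReal 0 1) := by
  have h := (memLp_id_gaussianReal (μ := 0) (v := 1) (k : NNReal)).integrable_norm_pow'
  refine h.mono' (by fun_prop) (Filter.Eventually.of_forall fun x => ?_)
  simp

lemma integrable_pow_mul_gaussianPDFReal (k : ℕ) :
    Integrable (fun x : ℝ => x ^ k * gaussianPDFReal 0 1 x) := by
  have h := integrable_pow_gaussianReal k
  rw [gaussianReal_of_var_ne_zero _ one_ne_zero,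
    integrable_withDensity_iff (measurable_gaussianPDF 0 1)
      (Filter.Eventually.of_forall fun _ => gaussianPDF_lt_top)] at h
  simpa [toReal_gaussianPDF] using h

lemma hasDerivAt_gaussianPDFReal (x : ℝ) :
    HasDerivAt (gaussianPDFReal 0 1) (-(x * gaussianPDFReal 0 1 x)) x := by
  have h : HasDerivAt (fun y : ℝ => -(y - 0) ^ 2 / (2 * ((1 : NNReal) : ℝ))) (-x) x := by
    refine (((hasDerivAt_id' x).sub_const 0).fun_pow 2).fun_neg.div_const _ |>.congr_deriv ?_
    simp
    ring
  refine (h.exp.const_mul (√(2 * Real.pi * ((1 : NNReal) : ℝ)))⁻¹).congr_deriv ?_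
  rw [gaussianPDFReal_def]
  ring

/-- Stein's identity for the moments of the standard Gaussian law. -/
lemma integral_pow_succ_gaussianReal (k : ℕ) :
    ∫ x, x ^ (k + 1) ∂(gaussianReal 0 1) = k * ∫ x, x ^ (k - 1) ∂(gaussianReal 0 1) := by
  -- Integration by parts with `φ' = -xφ`. At `k = 0` the truncated exponent `k - 1` is harmless
  -- because of the factor `k`.
  have h := integral_mul_deriv_eq_deriv_mul_of_integrable (u := fun x : ℝ => x ^ k)
    (v := gaussianPDFReal 0 1) (u' := fun x => k * x ^ (k - 1))
    (v' := fun x => -(x * gaussianPDFReal 0 1 x))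
    (fun x _ => by simpa using hasDerivAt_pow k x) (fun x _ => hasDerivAt_gaussianPDFReal x)
    ((integrable_pow_mul_gaussianPDFReal (k + 1)).neg.congr
      (Filter.Eventually.of_forall fun x => by simp [pow_succ, mul_assoc]))
    (((integrable_pow_mul_gaussianPDFReal (k - 1)).const_mul (k : ℝ)).congr
      (Filter.Eventually.of_forall fun x => by simp [mul_assoc]))
    (integrable_pow_mul_gaussianPDFReal k)
  simp only [integral_gaussianReal_eq_integral_smul one_ne_zero, smul_eq_mul]
  rw [← integral_const_mul]
  simp only [mul_neg, integral_neg, neg_inj] at h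
  calc _ = ∫ x, x ^ k * (x * gaussianPDFReal 0 1 x) := by
        congr 1 with x
        ring
    _ = _ := by
        rw [h]
        congr 1 with x
        ring

end GaussianMoments

/-! ### The null expectation as a Gaussian functional -/

section NullLaw

variable {n d p : ℕ}

instance : IsProbabilityMeasure (gaussianTensor d p) := by
  unfold gaussianTensor
  infer_instance

instance : IsProbabilityMeasure (nullLaw n d p) := by
  unfold nullLaw
  infer_instance

lemma polyEval_monomial (s : Coord n d p →₀ ℕ) (a : ℝ) (z : Data n d p) :
    polyEval (monomial s a) z =
      a * ∏ i, ((z i).1 ^ s (i, none) * ∏ j, (z i).2 j ^ s (i, some j)) := by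
  rw [polyEval, eval_monomial, Finsupp.prod_fintype _ _ (by simp), Fintype.prod_prod_type]
  simp only [Fintype.prod_option, coordValue]

lemma polyEval_add (f g : MvPolynomial (Coord n d p) ℝ) (z : Data n d p) :
    polyEval (f + g) z = polyEval f z + polyEval g z := map_add _ _ _

lemma integrable_polyEval_nullLaw (f : MvPolynomial (Coord n d p) ℝ) :
    Integrable (polyEval f) (nullLaw n d p) := by
  induction f using MvPolynomial.induction_on' with
  | monomial s a =>
    have h := Integrable.const_mul (Integrable.fintype_prod (ι := Fin n)
      (μ := fun _ => (gaussianReal 0 1).prod (gaussianTensor d p))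
      (f := fun i x => x.1 ^ s (i, none) * ∏ j, x.2 j ^ s (i, some j)) fun i =>
        (integrable_pow_gaussianReal (s (i, none))).mul_prod
          (Integrable.fintype_prod (μ := fun _ : Fin d → Fin p => gaussianReal 0 1)
            (f := fun j x => x ^ s (i, some j)) fun j => integrable_pow_gaussianReal _)) a
    exact h.congr (Filter.Eventually.of_forall fun z => (polyEval_monomial s a z).symm)
  | add f g hf hg =>
    exact (hf.add hg).congr (Filter.Eventually.of_forall fun z => (polyEval_add f g z).symm)

lemma integral_polyEval_monomial (s : Coord n d p →₀ ℕ) (a : ℝ) :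
    ∫ z, polyEval (monomial s a) z ∂(nullLaw n d p) =
      a * ∏ c, ∫ x, x ^ s c ∂(gaussianReal 0 1) := by
  simp only [polyEval_monomial]
  rw [integral_const_mul, nullLaw, Fintype.prod_prod_type, integral_fintype_prod_eq_prod
    (fun i (x : ℝ × Tensor d p) => x.1 ^ s (i, none) * ∏ j, x.2 j ^ s (i, some j))]
  congr 1
  refine Finset.prod_congr rfl fun i _ => ?_
  rw [Fintype.prod_option, integral_prod_mul (fun x : ℝ => x ^ s (i, none))
    (fun x : Tensor d p => ∏ j, x j ^ s (i, some j)), gaussianTensor,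
    integral_fintype_prod_eq_prod (fun j (x : ℝ) => x ^ s (i, some j))]

/-- The expectation of a polynomial under the null law, as a linear functional. -/
def nullExp (n d p : ℕ) : MvPolynomial (Coord n d p) ℝ →ₗ[ℝ] ℝ where
  toFun f := ∫ z, polyEval f z ∂(nullLaw n d p)
  map_add' f g := by
    simp only [polyEval_add]
    exact integral_add (integrable_polyEval_nullLaw f) (integrable_polyEval_nullLaw g)
  map_smul' a f := by
    rw [← integral_smul]
    simp [polyEval]

lemma nullExp_apply (f : MvPolynomial (Coord n d p) ℝ) :
    nullExp n d p f = ∫ z, polyEval f z ∂(nullLaw n d p) := rfl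

/-- On monomials both sides factor over coordinates; only the factor at `c` differs, and there the
one-dimensional moment recursion applies. -/
lemma isGaussianFunctional_nullExp : IsGaussianFunctional (nullExp n d p) where
  one := by simp [nullExp_apply, polyEval]
  stein c Q := by
    classical
    induction Q using MvPolynomial.induction_on' with
    | monomial s a =>
      rw [X, monomial_mul, one_mul, pderiv_monomial, nullExp_apply, nullExp_apply,
        integral_polyEval_monomial, integral_polyEval_monomial,
        ← Finset.mul_prod_erase _ _ (Finset.mem_univ c),
        ← Finset.mul_prod_erase Finset.univ (fun c' => ∫ x : ℝ, x ^ (s - Finsupp.single c 1 : _ →₀ ℕ) c'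
          ∂(gaussianReal 0 1)) (Finset.mem_univ c)]
      have h1 : ∏ c' ∈ Finset.univ.erase c,
          ∫ x : ℝ, x ^ (Finsupp.single c 1 + s : _ →₀ ℕ) c' ∂(gaussianReal 0 1) =
          ∏ c' ∈ Finset.univ.erase c, ∫ x : ℝ, x ^ (s - Finsupp.single c 1 : _ →₀ ℕ) c'
            ∂(gaussianReal 0 1) := by
        refine Finset.prod_congr rfl fun c' hc' => ?_
        have : c ≠ c' := (Finset.ne_of_mem_erase hc').symm
        simp [this]
      have h2 : ∫ x : ℝ, x ^ (Finsupp.single c 1 + s : _ →₀ ℕ) c ∂(gaussianReal 0 1) =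
          s c * ∫ x : ℝ, x ^ (s - Finsupp.single c 1 : _ →₀ ℕ) c ∂(gaussianReal 0 1) := by
        have := integral_pow_succ_gaussianReal (s c)
        simpa [add_comm] using this
      rw [h1, h2]
      ring
    | add f g hf hg => simp only [mul_add, map_add, hf, hg]

end NullLaw

/-! ### The planted law as a finite mixture of images of the null law -/

section PlantedLaw

variable {n d p : ℕ}

lemma plantedVectorLaw_eq_sum : plantedVectorLaw p =
    ∑ s : Fin p → ℤˣ, ((2 : ENNReal)⁻¹) ^ p • Measure.dirac (signVector s) := by
  have hfin : IsFiniteMeasure (scaledRademacher p) := by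
    constructor
    simp [scaledRademacher, ENNReal.inv_two_add_inv_two]
  refine Measure.pi_eq fun B hB => ?_
  have hB' (i : Fin p) : scaledRademacher p (B i) = ∑ ε : ℤˣ, (2 : ENNReal)⁻¹ *
      (B i).indicator 1 (((ε : ℤ) : ℝ) * (√(p : ℝ))⁻¹) := by
    simp [scaledRademacher, Measure.dirac_apply' _ (hB i)]
  simp only [hB', Finset.prod_univ_sum, Fintype.piFinset_univ, Finset.prod_mul_distrib,
    Finset.prod_const, Finset.card_univ, Fintype.card_fin, Measure.finsetSum_apply,
    Measure.smul_apply, smul_eq_mul]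
  refine Finset.sum_congr rfl fun s _ => ?_
  congr 1
  rw [Measure.dirac_apply' _ (MeasurableSet.univ_pi hB)]
  by_cases h : signVector s ∈ Set.univ.pi B
  · rw [Set.indicator_of_mem h, Pi.one_apply]
    refine (Finset.prod_eq_one fun i _ => ?_).symm
    exact Set.indicator_of_mem (h i (Set.mem_univ i)) _
  · rw [Set.indicator_of_notMem h]
    obtain ⟨i, hi⟩ : ∃ i, signVector s i ∉ B i := by simpa [Set.mem_pi] using h
    exact (Finset.prod_eq_zero (Finset.mem_univ i) (Set.indicator_of_notMem hi _)).symm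

/-- The regression data with planted vector `x` as a function of standard Gaussian data. -/
def plantMap (σ : ℝ) (x : Fin p → ℝ) (z : Data n d p) : Data n d p :=
  fun i => (tensorInner (plantedTensor d p σ x) (z i).2 + σ * (z i).1, (z i).2)

lemma measurable_regressionData (σ : ℝ) :
    Measurable (regressionData (n := n) (d := d) (p := p) σ) := by
  unfold regressionData tensorInner plantedTensor
  fun_prop

lemma measurable_plantMap (σ : ℝ) (x : Fin p → ℝ) :
    Measurable (plantMap (n := n) (d := d) σ x) := by
  unfold plantMap tensorInner
  fun_prop

/-- The null responses, scaled by `σ`, serve as the noise. This realizes the planted law on the null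
probability space. -/
lemma map_noise_nullLaw (σ : ℝ) :
    Measure.map (fun z : Data n d p => ((fun i => (z i).2), fun i => σ * (z i).1))
      (nullLaw n d p) = (Measure.pi fun _ : Fin n => gaussianTensor d p).prod
        (Measure.pi fun _ : Fin n => gaussianReal 0 (Real.toNNReal (σ ^ 2))) := by
  have hσ : MeasurePreserving (fun x : ℝ => σ * x) (gaussianReal 0 1)
      (gaussianReal 0 (Real.toNNReal (σ ^ 2))) := by
    refine ⟨by fun_prop, ?_⟩
    rw [gaussianReal_map_const_mul]
    congr 1
    · simp
    · ext
      simp [sq_nonneg]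
  have h1 := measurePreserving_arrowProdEquivProdArrow ℝ (Tensor d p) (Fin n)
    (fun _ => gaussianReal 0 1) (fun _ => gaussianTensor d p)
  have h2 := ((MeasurePreserving.id (Measure.pi fun _ : Fin n => gaussianTensor d p)).prod
    (measurePreserving_pi (fun _ : Fin n => gaussianReal 0 1) _ fun _ => hσ)).comp
      (Measure.measurePreserving_swap.comp h1)
  exact h2.map_eq

lemma plantedLaw_eq_sum (σ : ℝ) : plantedLaw n d p σ =
    ∑ s : Fin p → ℤˣ, ((2 : ENNReal)⁻¹) ^ p •
      Measure.map (plantMap σ (signVector s)) (nullLaw n d p) := by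
  have hreg := measurable_regressionData (n := n) (d := d) (p := p) σ
  have hΘ : Measurable (fun z : Data n d p => ((fun i => (z i).2), fun i => σ * (z i).1)) := by
    fun_prop
  ext B hB
  have hs (s : Fin p → ℤˣ) : ((Measure.pi fun _ : Fin n => gaussianTensor d p).prod
      (Measure.pi fun _ : Fin n => gaussianReal 0 (Real.toNNReal (σ ^ 2))))
        (Prod.mk (signVector s) ⁻¹' (regressionData σ ⁻¹' B)) =
      Measure.map (plantMap σ (signVector s)) (nullLaw n d p) B := by
    rw [← map_noise_nullLaw, Measure.map_apply hΘ (measurable_prodMk_left (hreg hB)),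
      Measure.map_apply (measurable_plantMap σ _) hB]
    rfl
  rw [plantedLaw, Measure.map_apply hreg hB, Measure.prod_apply (hreg hB),
    plantedVectorLaw_eq_sum, lintegral_finsetSum_measure, Measure.finsetSum_apply]
  refine Finset.sum_congr rfl fun s _ => ?_
  rw [lintegral_smul_measure, lintegral_dirac, hs, Measure.smul_apply]

lemma polyEval_plantMap (σ : ℝ) (x : Fin p → ℝ) (f : MvPolynomial (Coord n d p) ℝ)
    (z : Data n d p) :
    polyEval f (plantMap σ x z) = polyEval (plantSubst (plantedTensor d p σ x) σ f) z := by
  induction f using MvPolynomial.induction_on with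
  | C a => simp [polyEval, plantSubst]
  | add f g hf hg => rw [map_add, polyEval_add, polyEval_add, hf, hg]
  | mul_X f c hf =>
    have hmul (f g : MvPolynomial (Coord n d p) ℝ) (z : Data n d p) :
        polyEval (f * g) z = polyEval f z * polyEval g z := map_mul _ _ _
    rw [map_mul, hmul, hmul, hf]
    congr 1
    obtain ⟨i, _ | j⟩ := c
    · simp [plantSubst_X_none, polyEval, coordValue, plantMap, tensorInner]
    · simp [plantSubst_X_some, polyEval, coordValue, plantMap]

lemma measurable_polyEval (f : MvPolynomial (Coord n d p) ℝ) : Measurable (polyEval f) := by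
  have h : Measurable (coordValue (n := n) (d := d) (p := p)) := by
    refine measurable_pi_iff.2 fun c => ?_
    obtain ⟨i, _ | j⟩ := c <;> simp only [coordValue] <;> fun_prop
  exact (continuous_eval f).measurable.comp h

/-- The planted law averages the planted Gaussian laws over the vectors of signs. -/
lemma integrable_and_integral_polyEval_plantedLaw (σ : ℝ) (f : MvPolynomial (Coord n d p) ℝ) :
    Integrable (polyEval f) (plantedLaw n d p σ) ∧
      ∫ z, polyEval f z ∂(plantedLaw n d p σ) = ∑ s : Fin p → ℤˣ, ((2 : ℝ) ^ p)⁻¹ *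
        nullExp n d p (plantSubst (plantedTensor d p σ (signVector s)) σ f) := by
  have hc : ((2 : ENNReal)⁻¹) ^ p ≠ ⊤ := ENNReal.pow_ne_top (by simp)
  have hint (s : Fin p → ℤˣ) : Integrable (polyEval f)
      (((2 : ENNReal)⁻¹) ^ p • Measure.map (plantMap σ (signVector s)) (nullLaw n d p)) := by
    refine Integrable.smul_measure ?_ hc
    rw [integrable_map_measure (measurable_polyEval f).aestronglyMeasurable
      (measurable_plantMap σ _).aemeasurable]
    exact (integrable_polyEval_nullLaw _).congr
      (Filter.Eventually.of_forall fun z => (polyEval_plantMap σ (signVector s) f z).symm)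
  rw [plantedLaw_eq_sum]
  refine ⟨integrable_finsetSum_measure.2 fun s _ => hint s, ?_⟩
  rw [integral_finsetSum_measure fun s _ => hint s]
  refine Finset.sum_congr rfl fun s _ => ?_
  rw [integral_smul_measure, integral_map (measurable_plantMap σ _).aemeasurable
    (measurable_polyEval f).aestronglyMeasurable, nullExp_apply]
  simp only [polyEval_plantMap]
  simp

end PlantedLaw

/-! ### The low-degree ratio, its norm and the conclusion -/

section LowDegree

variable {n d p : ℕ}

/-- The low-degree likelihood ratio, minus its constant term. -/
def lowDegreeRatio (n d p D : ℕ) (σ : ℝ) : MvPolynomial (Coord n d p) ℝ :=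
  ∑ m ∈ Finset.Icc 1 D, ∑ s : Fin p → ℤˣ, (((2 : ℝ) ^ p)⁻¹ * (m.factorial : ℝ)⁻¹) •
    (adjPlantOp (plantedTensor d p σ (signVector s)) ^ m) 1

lemma integral_plantedLaw_eq (hp : 1 ≤ p) {D : ℕ} {σ : ℝ} (hσ : σ ^ 2 ≤ 1)
    {f : MvPolynomial (Coord n d p) ℝ} (hf : f.totalDegree ≤ D) :
    ∫ z, polyEval f z ∂(plantedLaw n d p σ) =
      nullExp n d p f + nullExp n d p (lowDegreeRatio n d p D σ * f) := by
  have hp' : (p : ℝ) ≠ 0 := by positivity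
  have hu (s : Fin p → ℤˣ) :
      ∑ j, plantedTensor d p σ (signVector s) j ^ 2 + σ ^ 2 = 1 := by
    have h1 : s * s = 1 := by
      ext i
      simp
    simp only [pow_two (plantedTensor _ _ _ _ _)]
    rw [sum_plantedTensor_mul d hσ, sum_signVector_mul_signVector, h1]
    simp [signSum, hp']
  rw [(integrable_and_integral_polyEval_plantedLaw σ f).2]
  simp only [isGaussianFunctional_nullExp.plantSubst_eq (hu _) hf, Finset.range_eq_Ico,
    Finset.sum_eq_sum_Ico_succ_bot (Nat.succ_pos D), mul_add, Finset.sum_add_distrib]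
  -- Order `m = 0` gives the null mean; the remaining orders form the pairing with `lowDegreeRatio`.
  congr 1
  · simp
  · rw [lowDegreeRatio, Finset.sum_mul, map_sum, Finset.sum_congr rfl fun s _ => Finset.mul_sum ..,
      Finset.sum_comm]
    refine Finset.sum_congr rfl fun m _ => ?_
    simp only [Finset.sum_mul, map_sum, smul_mul_assoc, map_smul, smul_eq_mul, mul_assoc]

/-- The squared norm of the low-degree likelihood ratio. -/
lemma nullExp_lowDegreeRatio_sq (D : ℕ) {σ : ℝ} (hσ : σ ^ 2 ≤ 1) :
    nullExp n d p (lowDegreeRatio n d p D σ * lowDegreeRatio n d p D σ) =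
      ∑ m ∈ Finset.Icc 1 D, (m.factorial : ℝ)⁻¹ * n.ascFactorial m * (4 ^ p : ℝ)⁻¹ *
        ∑ s : Fin p → ℤˣ, ∑ t : Fin p → ℤˣ,
          ((1 - σ ^ 2) * (∑ i, signVector s i * signVector t i) ^ d) ^ m := by
  have h4 : (4 : ℝ) ^ p = 2 ^ p * 2 ^ p := by rw [← mul_pow]; norm_num
  rw [lowDegreeRatio, Finset.sum_mul, map_sum]
  refine Finset.sum_congr rfl fun m hm => ?_
  rw [Finset.sum_mul, map_sum, Finset.mul_sum]
  refine Finset.sum_congr rfl fun s _ => ?_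
  have hm0 : (m.factorial : ℝ) ≠ 0 := by exact_mod_cast m.factorial_ne_zero
  have hl (l : ℕ) : nullExp n d p ((((2 : ℝ) ^ p)⁻¹ * (m.factorial : ℝ)⁻¹) •
      (adjPlantOp (plantedTensor d p σ (signVector s)) ^ m) 1 *
      ∑ t : Fin p → ℤˣ, (((2 : ℝ) ^ p)⁻¹ * (l.factorial : ℝ)⁻¹) •
        (adjPlantOp (plantedTensor d p σ (signVector t)) ^ l) 1) =
      if m = l then (m.factorial : ℝ)⁻¹ * n.ascFactorial m * (4 ^ p : ℝ)⁻¹ *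
        ∑ t : Fin p → ℤˣ, ((1 - σ ^ 2) * (∑ i, signVector s i * signVector t i) ^ d) ^ m
        else 0 := by
    simp only [Finset.mul_sum, map_sum, smul_mul_assoc, mul_smul_comm, map_smul, smul_eq_mul,
      isGaussianFunctional_nullExp.adjPlantOp_pow_mul_adjPlantOp_pow, sum_plantedTensor_mul d hσ,
      Fintype.card_fin]
    split_ifs with h
    · subst h
      refine Finset.sum_congr rfl fun t _ => ?_
      rw [h4]
      push_cast
      field_simp
    · simp
  rw [Finset.mul_sum, map_sum, Finset.sum_congr rfl fun l _ => hl l, Finset.sum_ite_eq, if_pos hm]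

lemma nullExp_mul_self_nonneg (g : MvPolynomial (Coord n d p) ℝ) : 0 ≤ nullExp n d p (g * g) := by
  rw [nullExp_apply]
  refine integral_nonneg fun z => ?_
  simp only [polyEval, map_mul, Pi.zero_apply]
  exact mul_self_nonneg _

/-- Cauchy–Schwarz, from the nonnegative squared norm of `g` minus its projection onto the unit
vector `f`. -/
lemma nullExp_mul_le_of_sq_le {f g : MvPolynomial (Coord n d p) ℝ} {a : ℝ} (ha : 0 ≤ a)
    (hf : nullExp n d p (f * f) = 1) (hg : nullExp n d p (g * g) ≤ a ^ 2) :
    nullExp n d p (g * f) ≤ a := by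
  have h := nullExp_mul_self_nonneg (g - nullExp n d p (g * f) • f)
  rw [show (g - nullExp n d p (g * f) • f) * (g - nullExp n d p (g * f) • f) =
      g * g - (2 * nullExp n d p (g * f)) • (g * f) +
        (nullExp n d p (g * f) * nullExp n d p (g * f)) • (f * f) by
    simp only [smul_eq_C_mul, C_mul, map_ofNat]
    ring, map_add, map_sub, map_smul, map_smul, hf, smul_eq_mul, smul_eq_mul] at h
  refine le_of_sq_le_sq ?_ ha
  nlinarith

lemma sum_Icc_half_pow_le (D : ℕ) : ∑ m ∈ Finset.Icc 1 D, (1 / 2 : ℝ) ^ m ≤ 1 := by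
  have h : ∑ m ∈ Finset.Icc 1 D, (1 / 2 : ℝ) ^ m = 1 - (1 / 2) ^ D := by
    induction D with
    | zero => simp
    | succ D ih =>
      rw [Finset.sum_Icc_succ_top (by omega), ih, pow_succ]
      ring
  rw [h]
  have : (0 : ℝ) ≤ (1 / 2) ^ D := by positivity
  linarith

/-- `k` bounds from below the orders that can contribute. For these `(δ/2)^m ≤ δ^k 2^{-m}`, and the
geometric series sums to at most 1. -/
lemma nullExp_lowDegreeRatio_sq_le {D k : ℕ} (hd : 1 ≤ d) (hp : 1 ≤ p) (hD : 1 ≤ D)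
    {σ δ : ℝ} (hσ : σ ^ 2 < 1) (hδ0 : 0 ≤ δ) (hδ1 : δ ≤ 1)
    (hn : (n : ℝ) ≤ ((p : ℝ) / ((d : ℝ) * (D : ℝ))) ^ ((d : ℝ) / 2) * δ / (2 * (1 - σ ^ 2)))
    (hk : ∀ m, 1 ≤ m → ¬Odd (d * m) → k ≤ m) :
    nullExp n d p (lowDegreeRatio n d p D σ * lowDegreeRatio n d p D σ) ≤ δ ^ k := by
  rw [nullExp_lowDegreeRatio_sq D hσ.le]
  calc _ ≤ ∑ m ∈ Finset.Icc 1 D, δ ^ k * (1 / 2 : ℝ) ^ m := by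
        refine Finset.sum_le_sum fun m hm => ?_
        rw [Finset.mem_Icc] at hm
        refine (advantage_term_le hd hp hD hm.2 hσ hn).trans ?_
        split_ifs with h
        · positivity
        · rw [div_eq_mul_one_div, mul_pow]
          exact mul_le_mul_of_nonneg_right (pow_le_pow_of_le_one hδ0 hδ1 (hk m hm.1 h))
            (by positivity)
    _ ≤ δ ^ k := by
        rw [← Finset.mul_sum]
        exact mul_le_of_le_one_right (by positivity) (sum_Icc_half_pow_le D)

/-- Low-degree polynomials do not separate the planted law from the null law. -/
lemma integral_plantedLaw_le {D : ℕ} (hd : 1 ≤ d) (hp : 1 ≤ p) (hD : 1 ≤ D)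
    {σ : ℝ} (hσ : σ ^ 2 < 1) {δ : ℝ} (hδ0 : 0 < δ) (hδ1 : δ < 1)
    (hn : (n : ℝ) ≤ ((p : ℝ) / ((d : ℝ) * (D : ℝ))) ^ ((d : ℝ) / 2) * δ / (2 * (1 - σ ^ 2)))
    {f : MvPolynomial (Coord n d p) ℝ} (hdeg : f.totalDegree ≤ D)
    (hmean : ∫ z, polyEval f z ∂(nullLaw n d p) = 0)
    (hvar : variance (polyEval f) (nullLaw n d p) = 1) :
    Integrable (polyEval f) (plantedLaw n d p σ) ∧
      ∫ z, polyEval f z ∂(plantedLaw n d p σ)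
        ≤ √(δ / (1 - δ)) ∧
      (Odd d →
        ∫ z, polyEval f z ∂(plantedLaw n d p σ)
          ≤ δ / (1 - δ)) := by
  have hδ' : 0 < 1 - δ := by linarith
  have hle : δ ≤ δ / (1 - δ) := by
    rw [le_div_iff₀ hδ']
    nlinarith
  have hone : nullExp n d p (f * f) = 1 := by
    rw [variance_of_integral_eq_zero (measurable_polyEval f).aemeasurable hmean] at hvar
    rw [nullExp_apply, ← hvar]
    refine integral_congr_ae (Filter.Eventually.of_forall fun z => ?_)
    simp [polyEval, pow_two]
  have hE : ∫ z, polyEval f z ∂(plantedLaw n d p σ) =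
      nullExp n d p (lowDegreeRatio n d p D σ * f) := by
    rw [integral_plantedLaw_eq hp hσ.le hdeg, nullExp_apply f, hmean, zero_add]
  refine ⟨(integrable_and_integral_polyEval_plantedLaw σ f).1, ?_, fun hodd => ?_⟩
  · rw [hE]
    refine nullExp_mul_le_of_sq_le (Real.sqrt_nonneg _) hone ?_
    rw [Real.sq_sqrt (hδ0.le.trans hle)]
    refine le_trans ?_ hle
    simpa using nullExp_lowDegreeRatio_sq_le (k := 1) hd hp hD hσ hδ0.le hδ1.le hn
      fun m hm _ => hm
  · rw [hE]
    refine (nullExp_mul_le_of_sq_le hδ0.le hone ?_).trans hle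
    -- For odd `d` the order `m = 1` involves an odd overlap moment, so contributions start at `m =
    -- 2`.
    refine nullExp_lowDegreeRatio_sq_le (k := 2) hd hp hD hσ hδ0.le hδ1.le hn fun m hm hm' => ?_
    by_contra hlt
    obtain rfl : m = 1 := by omega
    exact hm' (by simpa using hodd)

end LowDegree

end TensorRegression
end

theorem mainTheorem3 (n d p D : ℕ) (hd : 1 ≤ d) (hp : 1 ≤ p) (hD : 1 ≤ D)
    (σ : ℝ) (hσ : σ ^ 2 < 1) (δ : ℝ) (hδ0 : 0 < δ) (hδ1 : δ < 1)
    (hn : (n : ℝ) ≤ ((p : ℝ) / ((d : ℝ) * (D : ℝ))) ^ ((d : ℝ) / 2) * δ / (2 * (1 - σ ^ 2)))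
    (f : MvPolynomial (TensorRegression.Coord n d p) ℝ) (hdeg : f.totalDegree ≤ D)
    (hmean : ∫ z, TensorRegression.polyEval f z ∂(TensorRegression.nullLaw n d p) = 0)
    (hvar : variance (TensorRegression.polyEval f) (TensorRegression.nullLaw n d p) = 1) :
    Integrable (TensorRegression.polyEval f) (TensorRegression.plantedLaw n d p σ) ∧
      ∫ z, TensorRegression.polyEval f z ∂(TensorRegression.plantedLaw n d p σ)
        ≤ √(δ / (1 - δ)) ∧
      (Odd d →
        ∫ z, TensorRegression.polyEval f z ∂(TensorRegression.plantedLaw n d p σ)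
          ≤ δ / (1 - δ)) := by
  exact TensorRegression.integral_plantedLaw_le hd hp hD hσ hδ0 hδ1 hn hdeg hmean hvar
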